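/- Let $\kappa_0,\kappa_1,\kappa_t\in\mathbb C$ and $c\in\mathbb C\setminus\{0,1\}$. Put $E(t,\lambda)=\lambda(\lambda-1)(\lambda-t)$, $F(t,\lambda)=\kappa_0(\lambda-1)(\lambda-t)+\kappa_1\lambda(\lambda-t)+(\kappa_t+1)\lambda(\lambda-1)$, and let subscripts $\lambda$ denote $\partial/\partial\lambda$. The second variational equation of the sixth Painlevé foliation along the vertical leaf $D_0(c)=\mathbb P^1\setminus\{0,1,c,\infty\}$ is the linear system $$\frac{d}{d\lambda}\begin{pmatrix}\eta_2\\ \xi_2\\ u_1\\ v_1\end{pmatrix}=\begin{pmatrix}0&b&g&f\\0&a&e&d\\0&0&a&b\\0&0&0&2a\end{pmatrix}\begin{pmatrix}\eta_2\\ \xi_2\\ u_1\\ v_1\end{pmatrix},$$ where, with $E,F,E_\lambda,F_\lambda$ evaluated at $(c,\lambda)$, $$a=\frac{E_\lambda}{2E},\quad b=\frac{c(c-1)}{2E},\quad d=\frac{2EF_\lambda-E_\lambda F}{4E^2},\quad e=\frac{-(2\lambda-1)E+\lambda(\lambda-1)E_\lambda}{2E^2},$$ $$f=-\frac{c(c-1)F}{4E^2},\quad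 g=\frac{(2c-1)E+c(c-1)\lambda(\lambda-1)}{2E^2}.$$ Let $S_c$ be the elliptic curve $y^2=\lambda(\lambda-1)(\lambda-c)$, let $(p,q)\in S_c$ be a point with $q\neq 0$, and let $\Phi$ be a fundamental matrix of this system near $\lambda=p$. For a piecewise $C^1$ closed loop $\alpha$ on $S_c$ based at $(p,q)$ and avoiding the ramification points over $0,1,c,\infty$, analytic continuation of $\Phi$ along the projection of $\alpha$ to the $\lambda$-plane exists and yields $\Phi\,T_\alpha$ for a unique constant matrix $T_\alpha$, the monodromy matrix along $\alpha$. There are polynomials $Q_{ij}\in\mathbb C[X,Y]$ $(1\le i,j\le 4)$ of total degree at most $2$, not depending on $\alpha$, such that for every such loop $\alpha$ $$(T_\alpha)_{ij}=Q_{ij}\!\left(\int_\alpha\frac{d\lambda}{y},\ \int_\alpha\frac{\lambda\,d\lambda}{y}\right),$$ that is, the entries of $T_\alpha$ are quadratic polynomials in the complete elliptic integrals of the first and second kind along $\alpha$. -/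

import Mathlib

open Set Filter Topology

noncomputable section

namespace PainleveSix

/-- The cubic `E(t, x) = x (x - 1) (x - t)`; the argument `x` is the variable `λ`. -/
def E (t x : ℂ) : ℂ := x * (x - 1) * (x - t)

/-- `F(t, x) = κ₀ (x - 1)(x - t) + κ₁ x (x - t) + (κₜ + 1) x (x - 1)`. -/
def F (k0 k1 kt t x : ℂ) : ℂ :=
  k0 * (x - 1) * (x - t) + k1 * x * (x - t) + (kt + 1) * x * (x - 1)

/-- The partial derivative `∂E/∂λ`. -/
def Elam (t x : ℂ) : ℂ := deriv (fun z => E t z) x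

/-- The partial derivative `∂F/∂λ`. -/
def Flam (k0 k1 kt t x : ℂ) : ℂ := deriv (fun z => F k0 k1 kt t z) x

/-! The coefficients of the second variational equation along `{μ = 0, t = c}`. -/

def coeffA (c x : ℂ) : ℂ := Elam c x / (2 * E c x)

def coeffB (c x : ℂ) : ℂ := c * (c - 1) / (2 * E c x)

def coeffD (k0 k1 kt c x : ℂ) : ℂ :=
  (2 * E c x * Flam k0 k1 kt c x - Elam c x * F k0 k1 kt c x) / (4 * E c x ^ 2)

def coeffE (c x : ℂ) : ℂ :=
  (-(2 * x - 1) * E c x + x * (x - 1) * Elam c x) / (2 * E c x ^ 2)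

def coeffF (k0 k1 kt c x : ℂ) : ℂ :=
  -(c * (c - 1) * F k0 k1 kt c x) / (4 * E c x ^ 2)

def coeffG (c x : ℂ) : ℂ :=
  ((2 * c - 1) * E c x + c * (c - 1) * x * (x - 1)) / (2 * E c x ^ 2)

/-- The matrix of the second variational equation, written as a linear system for the
column `(η₂, ξ₂, u₁, v₁)`, where `u₁ = ξ₁ η₁` and `v₁ = ξ₁ ^ 2`. -/
def secondVariationalMatrix (k0 k1 kt c x : ℂ) : Matrix (Fin 4) (Fin 4) ℂ :=
  !![0, coeffB c x, coeffG c x, coeffF k0 k1 kt c x;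
     0, coeffA c x, coeffE c x, coeffD k0 k1 kt c x;
     0, 0, coeffA c x, coeffB c x;
     0, 0, 0, 2 * coeffA c x]

/-- `Φ` is (the germ at `p` of) a fundamental matrix of the linear system `X' = A(x) X`. -/
def IsFundamentalMatrixAt (A : ℂ → Matrix (Fin 4) (Fin 4) ℂ) (p : ℂ)
    (Φ : ℂ → Matrix (Fin 4) (Fin 4) ℂ) : Prop :=
  (∀ᶠ z in 𝓝 p, ∀ i j, HasDerivAt (fun w => Φ w i j) ((A z * Φ z) i j) z) ∧
    (Φ p).det ≠ 0

/-- The family of matrix function elements `Ψ s`, `s ∈ [0, 1]`, is an analytic continuation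
along the path `γ : [0, 1] → ℂ`: each `Ψ s` is analytic at `γ s`, and for `s'` near `s` the
germ of `Ψ s'` at `γ s'` is the germ of `Ψ s` there. -/
def IsAnalyticContinuationAlong (γ : ℝ → ℂ) (Ψ : ℝ → ℂ → Matrix (Fin 4) (Fin 4) ℂ) : Prop :=
  ∀ s ∈ Icc (0 : ℝ) 1,
    (∀ i j, AnalyticAt ℂ (fun z => Ψ s z i j) (γ s)) ∧
    ∀ᶠ s' in 𝓝[Icc (0 : ℝ) 1] s, Ψ s' =ᶠ[𝓝 (γ s')] Ψ s

/-- `T` is the monodromy matrix of the fundamental matrix `Φ` along the closed path `γ`: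
analytic continuation along `γ` carries `Φ` to `Φ T`. -/
def IsMonodromyMatrix (Φ : ℂ → Matrix (Fin 4) (Fin 4) ℂ) (γ : ℝ → ℂ)
    (T : Matrix (Fin 4) (Fin 4) ℂ) : Prop :=
  ∃ Ψ : ℝ → ℂ → Matrix (Fin 4) (Fin 4) ℂ,
    IsAnalyticContinuationAlong γ Ψ ∧
    Ψ 0 =ᶠ[𝓝 (γ 0)] Φ ∧
    Ψ 1 =ᶠ[𝓝 (γ 1)] fun z => Φ z * T

/-- `γ` is piecewise `C¹` on `[0, 1]`: it is `C¹` on each closed interval of a subdivision. -/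
def IsPiecewiseC1 (γ : ℝ → ℂ) : Prop :=
  ∃ (n : ℕ) (τ : ℕ → ℝ), Monotone τ ∧ τ 0 = 0 ∧ τ n = 1 ∧
    ∀ i < n, ContDiffOn ℝ 1 γ (Icc (τ i) (τ (i + 1)))

/-- A closed loop on the elliptic curve `S_c : y ^ 2 = x (x - 1) (x - c)`, based at `(p, q)`
and avoiding the four ramification points over `0, 1, c, ∞`: a closed path `lam` on the
sphere punctured at these points together with a closed lift `(lam, y)` to `S_c`. -/
structure EllipticLoop (c p q : ℂ) where
  lam : ℝ → ℂ
  y : ℝ → ℂ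
  piecewiseC1_lam : IsPiecewiseC1 lam
  continuousOn_y : ContinuousOn y (Icc 0 1)
  on_curve : ∀ s ∈ Icc (0 : ℝ) 1, y s ^ 2 = E c (lam s)
  avoids : ∀ s ∈ Icc (0 : ℝ) 1, lam s ≠ 0 ∧ lam s ≠ 1 ∧ lam s ≠ c
  lam_zero : lam 0 = p
  lam_one : lam 1 = p
  y_zero : y 0 = q
  y_one : y 1 = q

/-- The complete elliptic integral of the first kind along `α`, `∫_α dλ / y`. -/
def EllipticLoop.firstKind {c p q : ℂ} (α : EllipticLoop c p q) : ℂ :=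
  ∫ s in (0 : ℝ)..1, deriv α.lam s / α.y s

/-- The complete elliptic integral of the second kind along `α`, `∫_α λ dλ / y`. -/
def EllipticLoop.secondKind {c p q : ℂ} (α : EllipticLoop c p q) : ℂ :=
  ∫ s in (0 : ℝ)..1, α.lam s * deriv α.lam s / α.y s

end PainleveSix

end

noncomputable section

namespace PainleveSix

/-! The system is triangular and can be solved by quadratures. With `y ^ 2 = E`, `i = ∫ dλ / y` and
`j = ∫ λ dλ / y`, every integral that occurs reduces to `i`, `j` and rational functions on the
elliptic curve. This gives the fundamental matrix `explicitSolution`, whose entries are polynomials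
in `i`, `j` over functions of `(λ, y)`.

Continuation along a closed loop on the curve restores `λ` and `y` and adds the periods to `i` and
`j`. By `explicitSolution_add` this is right multiplication by `explicitMonodromy`, which is
quadratic in the periods. Any other fundamental matrix is `explicitSolution` times a constant
invertible `C` (`eventuallyEq_mul_of_hasDerivAt`), so its monodromy is conjugate by `C`, and
conjugation preserves the degree bound. `EllipticLoop.isMonodromyMatrix` performs the continuation;
`IsMonodromyMatrix.unique` rests on the identity theorem. -/

lemma hasDerivAt_E (c z : ℂ) :
    HasDerivAt (fun w => E c w) (z * (z - 1) + (2 * z - 1) * (z - c)) z := by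
  have h := (((hasDerivAt_id z).mul ((hasDerivAt_id z).sub_const 1)).mul
    ((hasDerivAt_id z).sub_const c))
  refine h.congr_deriv ?_
  simp only [id, Pi.mul_apply]
  ring

lemma Elam_eq (c z : ℂ) : Elam c z = z * (z - 1) + (2 * z - 1) * (z - c) :=
  (hasDerivAt_E c z).deriv

lemma hasDerivAt_F (k0 k1 kt c z : ℂ) :
    HasDerivAt (fun w => F k0 k1 kt c w)
      (k0 * (2 * z - 1 - c) + k1 * (2 * z - c) + (kt + 1) * (2 * z - 1)) z := by
  have h0 := hasDerivAt_id z
  have h := (((h0.sub_const 1).const_mul k0).mul (h0.sub_const c)).add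
    (((h0.const_mul k1).mul (h0.sub_const c)).add
    ((h0.const_mul (kt + 1)).mul (h0.sub_const 1)))
  refine (h.congr_of_eventuallyEq (Eventually.of_forall fun w => ?_)).congr_deriv ?_
  · simp only [F, id, Pi.add_apply, Pi.mul_apply]; ring
  · simp only [id]; ring

lemma Flam_eq (k0 k1 kt c z : ℂ) : Flam k0 k1 kt c z =
    k0 * (2 * z - 1 - c) + k1 * (2 * z - c) + (kt + 1) * (2 * z - 1) :=
  (hasDerivAt_F k0 k1 kt c z).deriv

lemma E_ne_zero_iff {c z : ℂ} : E c z ≠ 0 ↔ z ≠ 0 ∧ z ≠ 1 ∧ z ≠ c := by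
  simp [E, sub_eq_zero, not_or, and_assoc]

/-! ### Explicit solution by quadratures -/

/-- The combination of elliptic integrals of the first and second kind occurring in the
solutions of the second variational equation. -/
def mixedIntegral (c i j : ℂ) : ℂ := (2 * c - 1) / 2 * i + (j - c * i) / 4

/-- A fundamental matrix of the second variational equation at the point `z`, in terms of
the values `y` of the square root of `E` and `i`, `j` of the elliptic integrals of the first
and second kind. -/
def explicitSolution (k0 k1 kt c z y i j : ℂ) : Matrix (Fin 4) (Fin 4) ℂ :=
  !![1, c * (c - 1) / 2 * i, -y / (2 * (z - c)) + mixedIntegral c i j,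
        c * (c - 1) / 2 * ((2 * c - 1) / 4 * i ^ 2 - i * y / (2 * (z - c))
          + i * (j - c * i) / 4);
     0, y, -y / (2 * (z - c)),
        F k0 k1 kt c z / 2 - z * (z - 1) / 2
          + y * (-(c * (c - 1) / 2 * i) / (2 * (z - c)) + (j - c * i) / 4);
     0, 0, y, c * (c - 1) / 2 * y * i;
     0, 0, 0, E c z]

/-- The monodromy matrix of `explicitSolution` when the elliptic integrals grow by `i`, `j`. -/
def explicitMonodromy (c i j : ℂ) : Matrix (Fin 4) (Fin 4) ℂ :=
  !![1, c * (c - 1) / 2 * i, mixedIntegral c i j,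
        c * (c - 1) / 2 * ((2 * c - 1) / 4 * i ^ 2 + i * (j - c * i) / 4);
     0, 1, 0, (j - c * i) / 4;
     0, 0, 1, c * (c - 1) / 2 * i;
     0, 0, 0, 1]

/-- The shift fixes `z` and `y`, so expanding a shifted column in `i'`, `j'` gives a combination of
the original columns with coefficients free of `z` and `y`. The parameters κ do not enter these
coefficients. -/
lemma explicitSolution_add (k0 k1 kt c z y i j i' j' : ℂ) :
    explicitSolution k0 k1 kt c z y (i + i') (j + j') =
      explicitSolution k0 k1 kt c z y i j * explicitMonodromy c i' j' := by
  ext a b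
  fin_cases a <;> fin_cases b <;>
    simp [explicitSolution, explicitMonodromy, Matrix.mul_apply, Fin.sum_univ_four,
      mixedIntegral] <;> ring

lemma det_explicitSolution (k0 k1 kt c z y i j : ℂ) :
    (explicitSolution k0 k1 kt c z y i j).det = y ^ 2 * E c z := by
  rw [Matrix.det_of_isUpperTriangular]
  · simp only [Fin.prod_univ_four, explicitSolution, Matrix.of_apply, Matrix.cons_val', Matrix.cons_val_zero,
      Matrix.cons_val_one, Matrix.cons_val, one_mul]
    ring
  · intro a b h
    fin_cases a <;> fin_cases b <;> simp_all [explicitSolution]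

/-- On the set `U`, `Y` is a branch of the square root of `E`, and `I`, `J` are branches of the
elliptic integrals of the first and second kind formed with `Y`. -/
structure IsEllipticBranch (c : ℂ) (U : Set ℂ) (Y I J : ℂ → ℂ) : Prop where
  E_ne_zero : ∀ z ∈ U, E c z ≠ 0
  sq_eq : ∀ z ∈ U, Y z ^ 2 = E c z
  hasDerivAt_Y : ∀ z ∈ U, HasDerivAt Y (coeffA c z * Y z) z
  hasDerivAt_I : ∀ z ∈ U, HasDerivAt I (Y z)⁻¹ z
  hasDerivAt_J : ∀ z ∈ U, HasDerivAt J (z * (Y z)⁻¹) z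

/-- Three identities drive the quadratures. First, `coeffE` is the derivative of `-1 / (2 (λ - c))`.
Second, `d(y / (λ - c)) = ((λ - c) - c (c - 1) / (λ - c)) dλ / (2 y)`, which trades the pole at `c`
for first and second kind integrals. Third, in the top row of the last column the terms in `F`
cancel. -/
lemma IsEllipticBranch.hasDerivAt_explicitSolution {c : ℂ} {U : Set ℂ} {Y I J : ℂ → ℂ}
    (h : IsEllipticBranch c U Y I J) (k0 k1 kt : ℂ) {z : ℂ} (hz : z ∈ U) (a b : Fin 4) :
    HasDerivAt (fun w => explicitSolution k0 k1 kt c w (Y w) (I w) (J w) a b)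
      ((secondVariationalMatrix k0 k1 kt c z *
        explicitSolution k0 k1 kt c z (Y z) (I z) (J z)) a b) z := by
  have hE := h.E_ne_zero z hz
  obtain ⟨h0, h1, hc⟩ := E_ne_zero_iff.1 hE
  have h1' := sub_ne_zero.2 h1
  have hc' := sub_ne_zero.2 hc
  have hsq := h.sq_eq z hz
  have hinv : (Y z)⁻¹ = Y z / E c z := by
    have : Y z ≠ 0 := by
      intro h'
      rw [h'] at hsq
      exact hE (by simpa using hsq.symm)
    field_simp
    exact hsq.symm
  have dY := h.hasDerivAt_Y z hz
  have dI := h.hasDerivAt_I z hz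
  have dJ := h.hasDerivAt_J z hz
  have dE := hasDerivAt_E c z
  have dF := hasDerivAt_F k0 k1 kt c z
  have dz := hasDerivAt_id z
  rw [hinv] at dI dJ
  have dq : HasDerivAt (fun w => -Y w / (2 * (w - c)))
      ((-(coeffA c z * Y z) * (2 * (z - c)) - -Y z * (2 * 1)) / (2 * (z - c)) ^ 2) z :=
    dY.neg.div ((dz.sub_const c).const_mul 2) (mul_ne_zero two_ne_zero hc')
  have dJI : HasDerivAt (fun w => (J w - c * I w) / 4)
      ((z * (Y z / E c z) - c * (Y z / E c z)) / 4) z :=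
    (dJ.sub (dI.const_mul c)).div_const 4
  have dG := ((dI.pow 2).const_mul ((2 * c - 1) / 4)).add ((dI.mul dq).add (dI.mul dJI))
  have dP := ((dF.div_const 2).sub ((dz.mul (dz.sub_const 1)).div_const 2)).add
    (dY.mul (((dI.div ((dz.sub_const c).const_mul 2) (mul_ne_zero two_ne_zero hc')).const_mul
      (-(c * (c - 1) / 2))).add dJI))
  have hsqE : Y z ^ 2 = z * (z - 1) * (z - c) := hsq
  fin_cases a <;> fin_cases b <;>
    simp only [explicitSolution, secondVariationalMatrix, Matrix.mul_apply, Fin.sum_univ_four,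
      mixedIntegral, Fin.mk_zero, Fin.mk_one, Fin.reduceFinMk, Matrix.of_apply, Matrix.cons_val',
      Matrix.cons_val_zero, Matrix.cons_val_one, Matrix.cons_val, Fin.isValue, zero_mul, mul_zero,
      add_zero, zero_add]
  · exact hasDerivAt_const _ _
  · refine (dI.const_mul _).congr_deriv ?_
    simp only [coeffB]
    ring
  · refine (dq.add ((dI.const_mul _).add dJI)).congr_deriv ?_
    simp only [coeffA, coeffB, coeffG, E, Elam_eq]
    field_simp
    ring
  · refine ((dG.const_mul (c * (c - 1) / 2)).congr_of_eventuallyEq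
      (Eventually.of_forall fun w => ?_)).congr_deriv ?_
    · simp only [Pi.add_apply, Pi.mul_apply, Pi.pow_apply]
      ring
    simp only [coeffA, coeffB, coeffG, coeffF, E, Elam_eq, F]
    field_simp
    -- The product of `Y` with the derivative of `I` leaves a multiple of `Y z ^ 2`, removed by the
    -- equation of the curve.
    linear_combination 8 * c * (1 - c) * hsqE
  · exact hasDerivAt_const _ _
  · exact dY
  · refine dq.congr_deriv ?_
    simp only [coeffA, coeffE, E, Elam_eq]
    field_simp
    ring
  · refine (dP.congr_of_eventuallyEq
      (Eventually.of_forall fun w => ?_)).congr_deriv ?_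
    · simp only [Pi.add_apply, Pi.mul_apply, Pi.sub_apply, Pi.div_apply, id]
      ring
    simp only [coeffA, coeffE, coeffD, E, Elam_eq, Flam_eq, F, id, Pi.add_apply, Pi.div_apply]
    field_simp
    linear_combination 8 * (z ^ 2 - 2 * z * c + c) * hsqE
  · exact hasDerivAt_const _ _
  · exact hasDerivAt_const _ _
  · exact dY
  · refine ((dY.const_mul (c * (c - 1) / 2)).mul dI).congr_deriv ?_
    simp only [coeffA, coeffB]
    linear_combination (c * (c - 1) / 2 / E c z) * hsq
  · exact hasDerivAt_const _ _
  · exact hasDerivAt_const _ _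
  · exact hasDerivAt_const _ _
  · refine dE.congr_deriv ?_
    rw [coeffA, Elam_eq]
    field_simp

/-! ### Local branches of the square root and of the elliptic integrals -/

lemma continuous_E (c : ℂ) : Continuous (E c) := by
  unfold E
  fun_prop

/-- Dividing `E c z` by `E c x` keeps the ratio near `1`, so the principal logarithm gives a
holomorphic root with value `y` at `x`. Holomorphic functions on a disc have primitives with
prescribed value at the centre. -/
lemma exists_isEllipticBranch {c x y : ℂ} (hE : E c x ≠ 0) (hy : y ^ 2 = E c x) (i j : ℂ) :
    ∃ (Y I J : ℂ → ℂ) (r : ℝ), 0 < r ∧ IsEllipticBranch c (Metric.ball x r) Y I J ∧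
      Y x = y ∧ I x = i ∧ J x = j := by
  have hy0 : y ≠ 0 := by
    rintro rfl
    exact hE (by simpa using hy.symm)
  have hcont : ContinuousAt (fun z => E c z / E c x) x :=
    (continuous_E c).continuousAt.div_const _
  have hev : ∀ᶠ z in 𝓝 x, E c z / E c x ∈ Complex.slitPlane :=
    hcont.eventually (Complex.isOpen_slitPlane.mem_nhds (by simp [hE]))
  obtain ⟨r, hr, hball⟩ := Metric.eventually_nhds_iff_ball.1 hev
  have hne : ∀ z ∈ Metric.ball x r, E c z ≠ 0 := fun z hz h0 =>
    Complex.slitPlane_ne_zero (hball z hz) (by simp [h0])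
  set Y : ℂ → ℂ := fun z => y * Complex.exp (Complex.log (E c z / E c x) / 2) with hY
  have hY0 : ∀ z, Y z ≠ 0 := fun z => mul_ne_zero hy0 (Complex.exp_ne_zero _)
  have hsq : ∀ z ∈ Metric.ball x r, Y z ^ 2 = E c z := fun z hz => by
    rw [hY]
    simp only
    rw [mul_pow, ← Complex.exp_nat_mul, Nat.cast_ofNat, mul_div_cancel₀ _ two_ne_zero,
      Complex.exp_log (div_ne_zero (hne z hz) hE), hy, mul_div_cancel₀ _ hE]
  have hYd : ∀ z ∈ Metric.ball x r, HasDerivAt Y (coeffA c z * Y z) z := fun z hz => by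
    have hz0 := hne z hz
    refine ((((((hasDerivAt_E c z).div_const (E c x)).clog (hball z hz)).div_const 2).cexp).const_mul
      y).congr_deriv ?_
    rw [coeffA, Elam_eq, hY]
    field_simp
  have hYdiff : DifferentiableOn ℂ Y (Metric.ball x r) := fun z hz =>
    (hYd z hz).differentiableAt.differentiableWithinAt
  have hinv : DifferentiableOn ℂ (fun z => (Y z)⁻¹) (Metric.ball x r) :=
    hYdiff.inv fun z _ => hY0 z
  obtain ⟨I, hIx, hI⟩ := hinv.isExactOn_ball.with_val_at x i
  obtain ⟨J, hJx, hJ⟩ := (differentiableOn_id.mul hinv).isExactOn_ball.with_val_at x j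
  exact ⟨Y, I, J, r, hr, ⟨hne, hsq, hYd, hI, hJ⟩, by simp [hY, hE], hIx, hJx⟩

lemma eventuallyEq_of_eventually_hasDerivAt {V : Type*} [NormedAddCommGroup V] [NormedSpace ℂ V]
    {f g d : ℂ → V} {x : ℂ}
    (hf : ∀ᶠ z in 𝓝 x, HasDerivAt f (d z) z) (hg : ∀ᶠ z in 𝓝 x, HasDerivAt g (d z) z)
    (hx : f x = g x) : f =ᶠ[𝓝 x] g := by
  obtain ⟨r, hr, hball⟩ := Metric.eventually_nhds_iff_ball.1 (hf.and hg)
  filter_upwards [Metric.ball_mem_nhds x hr] with z hz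
  have hd : ∀ w ∈ Metric.ball x r, HasDerivAt (f - g) 0 w := fun w hw => by
    simpa using (hball w hw).1.sub (hball w hw).2
  have := Metric.isOpen_ball.is_const_of_deriv_eq_zero (convex_ball x r).isPreconnected
    (fun w hw => (hd w hw).differentiableAt.differentiableWithinAt)
    (fun w hw => (hd w hw).deriv) hz (Metric.mem_ball_self hr)
  simpa [hx, sub_eq_zero] using this

lemma eq_of_sq_eq_of_add_ne_zero {a b : ℂ} (h : a ^ 2 = b ^ 2) (hab : a + b ≠ 0) : a = b := by
  have : (a + b) * (a - b) = 0 := by linear_combination h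
  exact sub_eq_zero.1 ((mul_eq_zero.1 this).resolve_left hab)

lemma IsEllipticBranch.ne_zero {c : ℂ} {U : Set ℂ} {Y I J : ℂ → ℂ}
    (h : IsEllipticBranch c U Y I J) {z : ℂ} (hz : z ∈ U) : Y z ≠ 0 := fun h0 =>
  h.E_ne_zero z hz (by rw [← h.sq_eq z hz, h0]; simp)

/-- Near `x` the sum `Y + Y'` stays away from `0`, which excludes opposite roots; the integrals then
have equal derivatives and equal values at `x`. -/
lemma IsEllipticBranch.eventuallyEq {c x : ℂ} {U V : Set ℂ} {Y I J Y' I' J' : ℂ → ℂ}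
    (h : IsEllipticBranch c U Y I J) (h' : IsEllipticBranch c V Y' I' J')
    (hU : U ∈ 𝓝 x) (hV : V ∈ 𝓝 x) (hY : Y x = Y' x) (hI : I x = I' x) (hJ : J x = J' x) :
    Y =ᶠ[𝓝 x] Y' ∧ I =ᶠ[𝓝 x] I' ∧ J =ᶠ[𝓝 x] J' := by
  have hxU := mem_of_mem_nhds hU
  have hYY : Y =ᶠ[𝓝 x] Y' := by
    have hne : Y x + Y' x ≠ 0 := by
      rw [← hY, ← two_mul]
      exact mul_ne_zero two_ne_zero (h.ne_zero hxU)
    have hc := ((h.hasDerivAt_Y x hxU).continuousAt.add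
      (h'.hasDerivAt_Y x (mem_of_mem_nhds hV)).continuousAt).eventually_ne hne
    filter_upwards [hc, hU, hV] with z hz hzU hzV
    exact eq_of_sq_eq_of_add_ne_zero ((h.sq_eq z hzU).trans (h'.sq_eq z hzV).symm) hz
  refine ⟨hYY, ?_, ?_⟩
  · refine eventuallyEq_of_eventually_hasDerivAt (d := fun z => (Y z)⁻¹) ?_ ?_ hI
    · filter_upwards [hU] with z hz using h.hasDerivAt_I z hz
    · filter_upwards [hV, hYY] with z hz hzY
      rw [hzY]
      exact h'.hasDerivAt_I z hz
  · refine eventuallyEq_of_eventually_hasDerivAt (d := fun z => z * (Y z)⁻¹) ?_ ?_ hJ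
    · filter_upwards [hU] with z hz using h.hasDerivAt_J z hz
    · filter_upwards [hV, hYY] with z hz hzY
      rw [hzY]
      exact h'.hasDerivAt_J z hz

/-! ### Integration along piecewise `C¹` paths -/

open MeasureTheory in
lemma intervalIntegrable_deriv_of_contDiffOn {γ : ℝ → ℂ} {a b : ℝ} (hab : a ≤ b)
    (h : ContDiffOn ℝ 1 γ (Icc a b)) : IntervalIntegrable (deriv γ) volume a b := by
  rcases hab.eq_or_lt with rfl | hlt
  · exact IntervalIntegrable.refl
  have hc : ContinuousOn (derivWithin γ (Icc a b)) (uIcc a b) := by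
    rw [uIcc_of_le hab]
    exact h.continuousOn_derivWithin (uniqueDiffOn_Icc hlt) le_rfl
  -- At a break point `deriv γ` need not agree with the one-sided derivative, so the comparison is
  -- made on the open interval.
  rw [intervalIntegrable_iff_integrableOn_Ioo_of_le hab]
  have := (intervalIntegrable_iff_integrableOn_Ioo_of_le hab).1 (hc.intervalIntegrable (μ := volume))
  refine this.congr_fun (fun s hs => ?_) measurableSet_Ioo
  exact derivWithin_of_mem_nhds (Icc_mem_nhds hs.1 hs.2)

lemma IsPiecewiseC1.continuousOn {γ : ℝ → ℂ} (h : IsPiecewiseC1 γ) :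
    ContinuousOn γ (Icc 0 1) := by
  obtain ⟨n, τ, hτ, h0, h1, hγ⟩ := h
  have key : ∀ m ≤ n, ContinuousOn γ (Icc (τ 0) (τ m)) := by
    intro m
    induction m with
    | zero => intro _; simp
    | succ m ih =>
      intro hm
      rw [← Icc_union_Icc_eq_Icc (hτ (Nat.zero_le m)) (hτ m.le_succ)]
      exact (ih (by omega)).union_of_isClosed (hγ m (by omega)).continuousOn isClosed_Icc
        isClosed_Icc
  simpa [h0, h1] using key n le_rfl

lemma IsPiecewiseC1.intervalIntegrable_deriv {γ : ℝ → ℂ} (h : IsPiecewiseC1 γ) :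
    IntervalIntegrable (deriv γ) MeasureTheory.volume 0 1 := by
  obtain ⟨n, τ, hτ, h0, h1, hγ⟩ := h
  rw [← h0, ← h1]
  exact IntervalIntegrable.trans_iterate fun i hi =>
    intervalIntegrable_deriv_of_contDiffOn (hτ i.le_succ) (hγ i hi)

lemma IsPiecewiseC1.exists_countable_differentiableAt {γ : ℝ → ℂ} (h : IsPiecewiseC1 γ) :
    ∃ S : Set ℝ, S.Countable ∧ ∀ s ∈ Icc (0 : ℝ) 1, s ∉ S → DifferentiableAt ℝ γ s := by
  obtain ⟨n, τ, hτ, h0, h1, hγ⟩ := h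
  refine ⟨range τ, countable_range τ, fun s hs hsτ => ?_⟩
  have key : ∀ m ≤ n, s ∈ Icc (τ 0) (τ m) → DifferentiableAt ℝ γ s := by
    intro m
    induction m with
    | zero =>
      intro _ hm
      exact absurd ⟨0, le_antisymm hm.1 hm.2⟩ hsτ
    | succ m ih =>
      intro hm hsm
      rcases le_total s (τ m) with hle | hle
      · exact ih (by omega) ⟨hsm.1, hle⟩
      · have hlt : τ m < s := lt_of_le_of_ne hle fun h => hsτ ⟨m, h⟩
        have hlt' : s < τ (m + 1) := lt_of_le_of_ne hsm.2 fun h => hsτ ⟨m + 1, h.symm⟩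
        exact ((hγ m (by omega)).differentiableOn one_ne_zero).differentiableAt
          (Icc_mem_nhds hlt hlt')
  exact key n le_rfl (by rwa [h0, h1])

/-- The fundamental theorem of calculus for a primitive along a piecewise `C¹` path. -/
lemma IsPiecewiseC1.sub_eq_integral {γ φ : ℝ → ℂ} (hγ : IsPiecewiseC1 γ)
    (hφ : ContinuousOn φ (Icc 0 1)) {G : ℂ → ℂ} {a b : ℝ} (ha : a ∈ Icc (0 : ℝ) 1)
    (hb : b ∈ Icc (0 : ℝ) 1) (hG : ∀ s ∈ uIcc a b, HasDerivAt G (φ s) (γ s)) :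
    G (γ b) - G (γ a) = ∫ s in a..b, deriv γ s * φ s := by
  obtain ⟨S, hS, hdiff⟩ := hγ.exists_countable_differentiableAt
  have hsub : uIcc a b ⊆ Icc 0 1 := uIcc_subset_Icc ha hb
  symm
  refine MeasureTheory.integral_eq_of_hasDerivAt_off_countable (fun s => G (γ s)) _ hS ?_ ?_ ?_
  · intro s hs
    exact (hG s hs).continuousAt.comp_continuousWithinAt
      ((hγ.continuousOn.mono hsub) s hs)
  · intro s hs
    have hs' : s ∈ uIcc a b := Ioo_subset_Icc_self hs.1
    exact ((hG s hs').scomp s (hdiff s (hsub hs') hs.2).hasDerivAt).congr_deriv (by simp)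
  · have : IntervalIntegrable (deriv γ) MeasureTheory.volume a b :=
      hγ.intervalIntegrable_deriv.mono_set (by rwa [uIcc_of_le (zero_le_one' ℝ)])
    exact this.mul_continuousOn (hφ.mono hsub)

lemma IsPiecewiseC1.eventually_comp_eq_integral {γ φ : ℝ → ℂ} (hγ : IsPiecewiseC1 γ)
    (hφ : ContinuousOn φ (Icc 0 1)) {G : ℂ → ℂ} {a : ℝ} (ha : a ∈ Icc (0 : ℝ) 1)
    (hG : ∀ᶠ s in 𝓝[Icc 0 1] a, HasDerivAt G (φ s) (γ s))
    (h0 : G (γ a) = ∫ s in (0 : ℝ)..a, deriv γ s * φ s) :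
    ∀ᶠ b in 𝓝[Icc (0 : ℝ) 1] a, G (γ b) = ∫ s in (0 : ℝ)..b, deriv γ s * φ s := by
  obtain ⟨ε, hε, hball⟩ := Metric.mem_nhdsWithin_iff.1 hG
  have hint : ∀ b ∈ Icc (0 : ℝ) 1,
      IntervalIntegrable (fun s => deriv γ s * φ s) MeasureTheory.volume 0 b := fun b hb => by
    have hsub : uIcc 0 b ⊆ Icc 0 1 := uIcc_subset_Icc (by simp) hb
    have : IntervalIntegrable (deriv γ) MeasureTheory.volume 0 b :=
      hγ.intervalIntegrable_deriv.mono_set (by rwa [uIcc_of_le (zero_le_one' ℝ)])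
    exact this.mul_continuousOn (hφ.mono hsub)
  filter_upwards [self_mem_nhdsWithin, mem_nhdsWithin_of_mem_nhds (Metric.ball_mem_nhds a hε)]
    with b hb hbε
  have hconv : uIcc a b ⊆ Metric.ball a ε ∩ Icc 0 1 :=
    subset_inter (((convex_ball a ε).ordConnected).uIcc_subset (Metric.mem_ball_self hε) hbε)
      (uIcc_subset_Icc ha hb)
  have := hγ.sub_eq_integral hφ ha hb fun s hs => hball (hconv hs)
  rw [← intervalIntegral.integral_interval_sub_left (hint b hb) (hint a ha), ← h0] at this
  exact sub_left_injective this

-- Uniqueness of solutions and of analytic continuation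

attribute [local instance] Matrix.linftyOpNormedRing Matrix.linftyOpNormedAlgebra in
/-- Two solutions of the same linear system, the first one invertible, differ by a constant
right factor. -/
lemma eventuallyEq_mul_of_hasDerivAt {n : Type*} [Fintype n] [DecidableEq n]
    {A M Φ : ℂ → Matrix n n ℂ} {p : ℂ}
    (hM : ∀ᶠ z in 𝓝 p, ∀ i j, HasDerivAt (fun w => M w i j) ((A z * M z) i j) z)
    (hdet : ∀ᶠ z in 𝓝 p, (M z).det ≠ 0)
    (hΦ : ∀ᶠ z in 𝓝 p, ∀ i j, HasDerivAt (fun w => Φ w i j) ((A z * Φ z) i j) z) :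
    Φ =ᶠ[𝓝 p] fun z => M z * ((M p)⁻¹ * Φ p) := by
  -- Since `(M⁻¹)' = -M⁻¹ A`, the derivative of `M⁻¹ Φ` vanishes.
  have hconst : (fun z => (M z)⁻¹ * Φ z) =ᶠ[𝓝 p] fun _ => (M p)⁻¹ * Φ p := by
    refine eventuallyEq_of_eventually_hasDerivAt (d := fun _ => 0) ?_
      (Eventually.of_forall fun z => hasDerivAt_const _ _) rfl
    filter_upwards [hM, hdet, hΦ] with z hMz hz hΦz
    have hMd : HasDerivAt M (A z * M z) z :=
      hasDerivAt_pi.2 fun i => hasDerivAt_pi.2 fun j => hMz i j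
    have hΦd : HasDerivAt Φ (A z * Φ z) z :=
      hasDerivAt_pi.2 fun i => hasDerivAt_pi.2 fun j => hΦz i j
    have hu : IsUnit (M z).det := isUnit_iff_ne_zero.2 hz
    have hinv := (hasFDerivAt_ringInverse (𝕜 := ℂ) ((M z).nonsingInvUnit hu)).comp_hasDerivAt z hMd
    have hinv' : HasDerivAt (fun w => (M w)⁻¹) (-((M z)⁻¹ * A z)) z := by
      refine (hinv.congr_of_eventuallyEq (Eventually.of_forall fun w => ?_)).congr_deriv ?_
      · exact Matrix.nonsing_inv_eq_ringInverse (M w)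
      · change -((M z)⁻¹ * (A z * M z) * (M z)⁻¹) = _
        rw [mul_assoc, mul_assoc, Matrix.mul_nonsing_inv _ hu, mul_one]
    refine (hinv'.mul hΦd).congr_deriv ?_
    rw [neg_mul, mul_assoc, neg_add_cancel]
  filter_upwards [hconst, hdet] with z hz hd
  rw [← hz, ← mul_assoc, Matrix.mul_nonsing_inv _ (isUnit_iff_ne_zero.2 hd), one_mul]

/-- By the identity theorem on a disc around `γ s`, whether the two germs agree is locally constant
in the time. Phrasing this as an equivalence gives openness and closedness together, and
connectedness of `[0, 1]` concludes. -/
lemma IsAnalyticContinuationAlong.eventuallyEq_one {γ : ℝ → ℂ}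
    {Ψ Ψ' : ℝ → ℂ → Matrix (Fin 4) (Fin 4) ℂ} (hγ : ContinuousOn γ (Icc 0 1))
    (h : IsAnalyticContinuationAlong γ Ψ) (h' : IsAnalyticContinuationAlong γ Ψ')
    (h0 : Ψ 0 =ᶠ[𝓝 (γ 0)] Ψ' 0) : Ψ 1 =ᶠ[𝓝 (γ 1)] Ψ' 1 := by
  have key : ∀ s ∈ Icc (0 : ℝ) 1, ∀ᶠ t in 𝓝[Icc (0 : ℝ) 1] s,
      (Ψ s =ᶠ[𝓝 (γ s)] Ψ' s ↔ Ψ t =ᶠ[𝓝 (γ t)] Ψ' t) := by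
    intro s hs
    obtain ⟨r, hr, hball⟩ : ∃ r > 0, ∀ z ∈ Metric.ball (γ s) r, ∀ i j,
        AnalyticAt ℂ (fun z => Ψ s z i j) z ∧ AnalyticAt ℂ (fun z => Ψ' s z i j) z := by
      refine Metric.eventually_nhds_iff_ball.1 ?_
      simp only [eventually_all]
      exact fun i j => ((h s hs).1 i j).eventually_analyticAt.and
        ((h' s hs).1 i j).eventually_analyticAt
    have hid : ∀ x ∈ Metric.ball (γ s) r, ∀ x' ∈ Metric.ball (γ s) r,
        Ψ s =ᶠ[𝓝 x] Ψ' s → Ψ s =ᶠ[𝓝 x'] Ψ' s := by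
      intro x hx x' hx' hxx
      filter_upwards [Metric.isOpen_ball.mem_nhds hx'] with z hz
      ext i j
      refine AnalyticOnNhd.eqOn_of_preconnected_of_eventuallyEq (𝕜 := ℂ)
        (f := fun z => Ψ s z i j) (g := fun z => Ψ' s z i j)
        (fun z hz => (hball z hz i j).1) (fun z hz => (hball z hz i j).2)
        (convex_ball (γ s) r).isPreconnected hx ?_ hz
      filter_upwards [hxx] with w hw
      rw [hw]
    have hmem : ∀ᶠ t in 𝓝[Icc (0 : ℝ) 1] s, γ t ∈ Metric.ball (γ s) r :=
      (hγ s hs).eventually (Metric.ball_mem_nhds _ hr)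
    filter_upwards [(h s hs).2, (h' s hs).2, hmem] with t ht ht' htm
    have hs_mem := Metric.mem_ball_self (x := γ s) hr
    exact ⟨fun hst => ht.trans ((hid _ hs_mem _ htm hst).trans ht'.symm),
      fun hst => hid _ htm _ hs_mem (ht.symm.trans (hst.trans ht'))⟩
  have := isPreconnected_Icc.induction₂ (s := Icc (0 : ℝ) 1)
    (fun s t => Ψ s =ᶠ[𝓝 (γ s)] Ψ' s ↔ Ψ t =ᶠ[𝓝 (γ t)] Ψ' t) key
    (fun _ _ _ _ _ _ hxy hyz => hxy.trans hyz) (fun _ _ _ _ hxy => hxy.symm)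
    (left_mem_Icc.2 zero_le_one) (right_mem_Icc.2 zero_le_one)
  exact this.1 h0

lemma IsMonodromyMatrix.unique {Φ : ℂ → Matrix (Fin 4) (Fin 4) ℂ} {γ : ℝ → ℂ} {p : ℂ}
    (hγ : ContinuousOn γ (Icc 0 1)) (h1 : γ 1 = p) (hdet : (Φ p).det ≠ 0)
    {T T' : Matrix (Fin 4) (Fin 4) ℂ} (h : IsMonodromyMatrix Φ γ T)
    (h' : IsMonodromyMatrix Φ γ T') : T = T' := by
  obtain ⟨Ψ, hΨ, hΨ0, hΨ1⟩ := h
  obtain ⟨Ψ', hΨ', hΨ0', hΨ1'⟩ := h'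
  have := (hΨ1.symm.trans ((hΨ.eventuallyEq_one hγ hΨ' (hΨ0.trans hΨ0'.symm)).trans
    hΨ1')).eq_of_nhds
  simp only [h1] at this
  have hu : IsUnit (Φ p).det := isUnit_iff_ne_zero.2 hdet
  rw [← one_mul T, ← one_mul T', ← Matrix.nonsing_inv_mul _ hu, mul_assoc, this, mul_assoc]

/-! ### Continuation of the explicit solution along a loop -/

lemma IsEllipticBranch.analyticAt_explicitSolution_mul {c : ℂ} {U : Set ℂ} {Y I J : ℂ → ℂ}
    (h : IsEllipticBranch c U Y I J) (k0 k1 kt : ℂ) (C : Matrix (Fin 4) (Fin 4) ℂ) {z : ℂ}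
    (hU : U ∈ 𝓝 z) (a b : Fin 4) :
    AnalyticAt ℂ (fun w => (explicitSolution k0 k1 kt c w (Y w) (I w) (J w) * C) a b) z := by
  rw [Complex.analyticAt_iff_eventually_differentiableAt]
  filter_upwards [hU] with w hw
  simp only [Matrix.mul_apply]
  exact DifferentiableAt.fun_sum fun i _ =>
    (h.hasDerivAt_explicitSolution k0 k1 kt hw a i).differentiableAt.mul_const _

namespace EllipticLoop

variable {c p q : ℂ} (α : EllipticLoop c p q)

lemma E_ne_zero {s : ℝ} (hs : s ∈ Icc (0 : ℝ) 1) : E c (α.lam s) ≠ 0 :=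
  E_ne_zero_iff.2 (α.avoids s hs)

lemma y_ne_zero {s : ℝ} (hs : s ∈ Icc (0 : ℝ) 1) : α.y s ≠ 0 := fun h0 =>
  α.E_ne_zero hs (by rw [← α.on_curve s hs, h0]; simp)

lemma continuousOn_inv_y : ContinuousOn (fun s => (α.y s)⁻¹) (Icc 0 1) :=
  α.continuousOn_y.inv₀ fun _ hs => α.y_ne_zero hs

/-- The elliptic integral of the first kind along the part of `α` up to the time `t`. -/
def partialFirstKind (t : ℝ) : ℂ := ∫ s in (0 : ℝ)..t, deriv α.lam s * (α.y s)⁻¹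

/-- The elliptic integral of the second kind along the part of `α` up to the time `t`. -/
def partialSecondKind (t : ℝ) : ℂ :=
  ∫ s in (0 : ℝ)..t, deriv α.lam s * (α.lam s * (α.y s)⁻¹)

lemma partialFirstKind_one : α.partialFirstKind 1 = α.firstKind := by
  simp only [partialFirstKind, firstKind, div_eq_mul_inv]

lemma partialSecondKind_one : α.partialSecondKind 1 = α.secondKind := by
  simp only [partialSecondKind, secondKind, div_eq_mul_inv]
  congr 1
  ext s
  ring

/-- A local branch that takes the values of `y` and of the elliptic integrals along `α` at one
time does so at all nearby times. -/
lemma eventually_branch_eq {U : Set ℂ} {Y I J : ℂ → ℂ} (h : IsEllipticBranch c U Y I J)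
    {s : ℝ} (hs : s ∈ Icc (0 : ℝ) 1) (hU : U ∈ 𝓝 (α.lam s)) (hY : Y (α.lam s) = α.y s)
    (hI : I (α.lam s) = α.partialFirstKind s) (hJ : J (α.lam s) = α.partialSecondKind s) :
    ∀ᶠ t in 𝓝[Icc (0 : ℝ) 1] s, U ∈ 𝓝 (α.lam t) ∧ Y (α.lam t) = α.y t ∧
      I (α.lam t) = α.partialFirstKind t ∧ J (α.lam t) = α.partialSecondKind t := by
  have hlam := α.piecewiseC1_lam.continuousOn
  have hUt : ∀ᶠ t in 𝓝[Icc (0 : ℝ) 1] s, U ∈ 𝓝 (α.lam t) :=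
    (hlam s hs).eventually (eventually_mem_nhds_iff.2 hU)
  have hYt : ∀ᶠ t in 𝓝[Icc (0 : ℝ) 1] s, Y (α.lam t) = α.y t := by
    have hc : ContinuousWithinAt (fun t => Y (α.lam t) + α.y t) (Icc 0 1) s :=
      ((h.hasDerivAt_Y _ (mem_of_mem_nhds hU)).continuousAt.comp_continuousWithinAt
        (hlam s hs)).add (α.continuousOn_y s hs)
    have hne : Y (α.lam s) + α.y s ≠ 0 := by
      rw [hY, ← two_mul]
      exact mul_ne_zero two_ne_zero (α.y_ne_zero hs)
    filter_upwards [hc.eventually_ne hne, hUt, self_mem_nhdsWithin] with t ht htU htI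
    exact eq_of_sq_eq_of_add_ne_zero
      ((h.sq_eq _ (mem_of_mem_nhds htU)).trans (α.on_curve t htI).symm) ht
  have hIt := α.piecewiseC1_lam.eventually_comp_eq_integral α.continuousOn_inv_y hs
    (G := I) (by
      filter_upwards [hUt, hYt] with t htU htY
      rw [← htY]
      exact h.hasDerivAt_I _ (mem_of_mem_nhds htU)) hI
  have hJt := α.piecewiseC1_lam.eventually_comp_eq_integral (hlam.mul α.continuousOn_inv_y) hs
    (G := J) (by
      filter_upwards [hUt, hYt] with t htU htY
      rw [Pi.mul_apply, ← htY]
      exact h.hasDerivAt_J _ (mem_of_mem_nhds htU)) hJ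
  filter_upwards [hUt, hYt, hIt, hJt] with t h1 h2 h3 h4 using ⟨h1, h2, h3, h4⟩

/-- At each time a local branch is chosen whose values at `α.lam s` are `α.y s` and the partial
integrals. Branches at nearby times agree because their values do, so they form an analytic
continuation. -/
lemma isMonodromyMatrix {U : Set ℂ} {Y I J : ℂ → ℂ} (h : IsEllipticBranch c U Y I J)
    (hU : U ∈ 𝓝 p) (hY : Y p = q) (hI : I p = 0) (hJ : J p = 0) (k0 k1 kt : ℂ)
    {Φ : ℂ → Matrix (Fin 4) (Fin 4) ℂ} {C : Matrix (Fin 4) (Fin 4) ℂ} (hC : C.det ≠ 0)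
    (hΦ : Φ =ᶠ[𝓝 p] fun z => explicitSolution k0 k1 kt c z (Y z) (I z) (J z) * C) :
    IsMonodromyMatrix Φ α.lam (C⁻¹ * explicitMonodromy c α.firstKind α.secondKind * C) := by
  have hex : ∀ s ∈ Icc (0 : ℝ) 1, ∃ (Y I J : ℂ → ℂ) (V : Set ℂ), V ∈ 𝓝 (α.lam s) ∧
      IsEllipticBranch c V Y I J ∧ Y (α.lam s) = α.y s ∧
      I (α.lam s) = α.partialFirstKind s ∧ J (α.lam s) = α.partialSecondKind s := by
    intro s hs
    obtain ⟨Y, I, J, r, hr, hb, h1, h2, h3⟩ := exists_isEllipticBranch (α.E_ne_zero hs)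
      (α.on_curve s hs) (α.partialFirstKind s) (α.partialSecondKind s)
    exact ⟨Y, I, J, _, Metric.ball_mem_nhds _ hr, hb, h1, h2, h3⟩
  choose! Ys Is Js V hV hb hYs hIs hJs using hex
  have zero_mem : (0 : ℝ) ∈ Icc (0 : ℝ) 1 := left_mem_Icc.2 zero_le_one
  have one_mem : (1 : ℝ) ∈ Icc (0 : ℝ) 1 := right_mem_Icc.2 zero_le_one
  refine ⟨fun s z => explicitSolution k0 k1 kt c z (Ys s z) (Is s z) (Js s z) * C,
    fun s hs => ⟨fun i j => (hb s hs).analyticAt_explicitSolution_mul k0 k1 kt C (hV s hs) i j,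
      ?_⟩, ?_, ?_⟩
  · filter_upwards [self_mem_nhdsWithin,
      α.eventually_branch_eq (hb s hs) hs (hV s hs) (hYs s hs) (hIs s hs) (hJs s hs)]
      with t ht htb
    obtain ⟨htV, h1, h2, h3⟩ := htb
    obtain ⟨e1, e2, e3⟩ := (hb t ht).eventuallyEq (hb s hs) (hV t ht) htV
      ((hYs t ht).trans h1.symm) ((hIs t ht).trans h2.symm) ((hJs t ht).trans h3.symm)
    filter_upwards [e1, e2, e3] with z h1 h2 h3
    rw [h1, h2, h3]
  · have hV0 := hV 0 zero_mem
    have hYs0 := hYs 0 zero_mem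
    have hIs0 := hIs 0 zero_mem
    have hJs0 := hJs 0 zero_mem
    simp only [α.lam_zero, α.y_zero, partialFirstKind, partialSecondKind,
      intervalIntegral.integral_same] at hV0 hYs0 hIs0 hJs0
    obtain ⟨e1, e2, e3⟩ := (hb 0 zero_mem).eventuallyEq h hV0 hU (hYs0.trans hY.symm)
      (hIs0.trans hI.symm) (hJs0.trans hJ.symm)
    rw [α.lam_zero]
    filter_upwards [e1, e2, e3, hΦ] with z h1 h2 h3 h4
    rw [h1, h2, h3, h4]
  · have hV1 := hV 1 one_mem
    have hYs1 := hYs 1 one_mem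
    have hIs1 := hIs 1 one_mem
    have hJs1 := hJs 1 one_mem
    rw [α.lam_one] at hV1 hYs1 hIs1 hJs1
    rw [α.y_one] at hYs1
    rw [partialFirstKind_one] at hIs1
    rw [partialSecondKind_one] at hJs1
    -- The loop closes up on the curve, so the final root is again `Y`; only the integrals have
    -- moved, by the full periods.
    have hshift : IsEllipticBranch c U Y (fun z => I z + α.firstKind)
        (fun z => J z + α.secondKind) :=
      { h with
        hasDerivAt_I := fun z hz => (h.hasDerivAt_I z hz).add_const _
        hasDerivAt_J := fun z hz => (h.hasDerivAt_J z hz).add_const _ }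
    obtain ⟨e1, e2, e3⟩ := (hb 1 one_mem).eventuallyEq hshift hV1 hU (hYs1.trans hY.symm)
      (by simp [hIs1, hI]) (by simp [hJs1, hJ])
    rw [α.lam_one]
    filter_upwards [e1, e2, e3, hΦ] with z h1 h2 h3 h4
    rw [h1, h2, h3, h4, explicitSolution_add]
    simp only [mul_assoc]
    rw [Matrix.mul_nonsing_inv_cancel_left _ _ (isUnit_iff_ne_zero.2 hC)]

end EllipticLoop

/-! ### Polynomial dependence on the periods -/

open MvPolynomial in
-- A term in `j ^ 2` is not needed: the second kind integral enters `explicitMonodromy` at most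
-- linearly.
lemma exists_quadratic_polynomial (r s t u v : ℂ) :
    ∃ P : MvPolynomial (Fin 2) ℂ, P.totalDegree ≤ 2 ∧
      ∀ i j, eval ![i, j] P = r * i ^ 2 + s * i * j + t * i + u * j + v := by
  have hX : ∀ n : Fin 2, (X n : MvPolynomial (Fin 2) ℂ).totalDegree ≤ 1 := fun n =>
    (totalDegree_X n).le
  have hC : ∀ (a : ℂ) {P : MvPolynomial (Fin 2) ℂ}, P.totalDegree ≤ 2 →
      (C a * P).totalDegree ≤ 2 := fun a P hP =>
    (totalDegree_mul _ _).trans (by rwa [totalDegree_C, zero_add])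
  have hadd : ∀ {P P' : MvPolynomial (Fin 2) ℂ}, P.totalDegree ≤ 2 → P'.totalDegree ≤ 2 →
      (P + P').totalDegree ≤ 2 := fun h h' => (totalDegree_add _ _).trans (max_le h h')
  refine ⟨C r * (X 0 * X 0) + C s * (X 0 * X 1) + C t * X 0 + C u * X 1 + C v, ?_,
    fun i j => ?_⟩
  · have hXX : ∀ n m : Fin 2, (X n * X m : MvPolynomial (Fin 2) ℂ).totalDegree ≤ 2 :=
      fun n m => (totalDegree_mul _ _).trans (add_le_add (hX n) (hX m))
    exact hadd (hadd (hadd (hadd (hC r (hXX 0 0)) (hC s (hXX 0 1)))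
      (hC t ((hX 0).trans one_le_two))) (hC u ((hX 1).trans one_le_two)))
      ((totalDegree_C v).le.trans zero_le_two)
  · simp
    ring

lemma exists_polynomial_explicitMonodromy (c : ℂ) :
    ∃ P : Fin 4 → Fin 4 → MvPolynomial (Fin 2) ℂ, (∀ a b, (P a b).totalDegree ≤ 2) ∧
      ∀ i j a b, MvPolynomial.eval ![i, j] (P a b) = explicitMonodromy c i j a b := by
  have hquad : ∀ a b, ∃ r s t u v : ℂ, ∀ i j, explicitMonodromy c i j a b =
      r * i ^ 2 + s * i * j + t * i + u * j + v := by
    have hconst : ∀ v : ℂ, ∃ r s t u v' : ℂ, ∀ i j : ℂ,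
        v = r * i ^ 2 + s * i * j + t * i + u * j + v' := fun v =>
      ⟨0, 0, 0, 0, v, fun i j => by ring⟩
    intro a b
    fin_cases a <;> fin_cases b <;>
      simp only [explicitMonodromy, mixedIntegral, Fin.mk_zero, Fin.mk_one, Fin.reduceFinMk,
        Matrix.of_apply, Matrix.cons_val', Matrix.cons_val_zero, Matrix.cons_val_one,
        Matrix.cons_val, Fin.isValue]
    · exact hconst _
    · exact ⟨0, 0, c * (c - 1) / 2, 0, 0, fun i j => by ring⟩
    · exact ⟨0, 0, (2 * c - 1) / 2 - c / 4, 1 / 4, 0, fun i j => by ring⟩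
    · exact ⟨c * (c - 1) / 2 * ((2 * c - 1) / 4 - c / 4), c * (c - 1) / 2 / 4, 0, 0, 0,
        fun i j => by ring⟩
    · exact hconst _
    · exact hconst _
    · exact hconst _
    · exact ⟨0, 0, -c / 4, 1 / 4, 0, fun i j => by ring⟩
    · exact hconst _
    · exact hconst _
    · exact hconst _
    · exact ⟨0, 0, c * (c - 1) / 2, 0, 0, fun i j => by ring⟩
    · exact hconst _
    · exact hconst _
    · exact hconst _
    · exact hconst _
  choose r s t u v h using hquad
  choose P hP heval using fun a b =>
    exists_quadratic_polynomial (r a b) (s a b) (t a b) (u a b) (v a b)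
  exact ⟨P, hP, fun i j a b => by rw [heval, h]⟩

lemma exists_polynomial_conj_explicitMonodromy (c : ℂ) (B C : Matrix (Fin 4) (Fin 4) ℂ) :
    ∃ P : Fin 4 → Fin 4 → MvPolynomial (Fin 2) ℂ, (∀ a b, (P a b).totalDegree ≤ 2) ∧
      ∀ i j a b, MvPolynomial.eval ![i, j] (P a b) = (B * explicitMonodromy c i j * C) a b := by
  obtain ⟨P, hP, heval⟩ := exists_polynomial_explicitMonodromy c
  refine ⟨fun a b => ∑ l, ∑ k, MvPolynomial.C (B a k * C l b) * P k l, fun a b => ?_,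
    fun i j a b => ?_⟩
  · refine MvPolynomial.totalDegree_finsetSum_le fun l _ =>
      MvPolynomial.totalDegree_finsetSum_le fun k _ => ?_
    refine (MvPolynomial.totalDegree_mul _ _).trans ?_
    rw [MvPolynomial.totalDegree_C, zero_add]
    exact hP k l
  · simp only [map_sum, map_mul, MvPolynomial.eval_C, heval, Matrix.mul_apply, Finset.sum_mul]
    exact Finset.sum_congr rfl fun l _ => Finset.sum_congr rfl fun k _ => by ring

end PainleveSix

end

theorem proposition2 (k0 k1 kt c : ℂ) (hc0 : c ≠ 0) (hc1 : c ≠ 1)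
    (p q : ℂ) (hq : q ^ 2 = PainleveSix.E c p) (hq0 : q ≠ 0)
    (Φ : ℂ → Matrix (Fin 4) (Fin 4) ℂ)
    (hΦ : PainleveSix.IsFundamentalMatrixAt
      (PainleveSix.secondVariationalMatrix k0 k1 kt c) p Φ) :
    ∃ Q : Fin 4 → Fin 4 → MvPolynomial (Fin 2) ℂ,
      (∀ i j, (Q i j).totalDegree ≤ 2) ∧
      ∀ α : PainleveSix.EllipticLoop c p q,
        (∃! T : Matrix (Fin 4) (Fin 4) ℂ, PainleveSix.IsMonodromyMatrix Φ α.lam T) ∧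
        ∀ T : Matrix (Fin 4) (Fin 4) ℂ, PainleveSix.IsMonodromyMatrix Φ α.lam T →
          ∀ i j, T i j = MvPolynomial.eval ![α.firstKind, α.secondKind] (Q i j) := by
  have hE : PainleveSix.E c p ≠ 0 := hq ▸ pow_ne_zero 2 hq0
  -- Both integrals start from `0` at `p`, matching the partial integrals along a loop at time `0`.
  obtain ⟨Y, I, J, r, hr, hb, hY, hI, hJ⟩ :=
    PainleveSix.exists_isEllipticBranch hE hq 0 0
  have hball := Metric.ball_mem_nhds p hr
  set M : ℂ → Matrix (Fin 4) (Fin 4) ℂ := fun z =>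
    PainleveSix.explicitSolution k0 k1 kt c z (Y z) (I z) (J z) with hM
  have hdet : ∀ᶠ z in 𝓝 p, (M z).det ≠ 0 := by
    filter_upwards [hball] with z hz
    rw [hM, PainleveSix.det_explicitSolution]
    exact mul_ne_zero (pow_ne_zero 2 (hb.ne_zero hz)) (hb.E_ne_zero z hz)
  have hMd : ∀ᶠ z in 𝓝 p, ∀ i j, HasDerivAt (fun w => M w i j)
      ((PainleveSix.secondVariationalMatrix k0 k1 kt c z * M z) i j) z := by
    filter_upwards [hball] with z hz i j
    exact hb.hasDerivAt_explicitSolution k0 k1 kt hz i j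
  have hΦM := PainleveSix.eventuallyEq_mul_of_hasDerivAt hMd hdet hΦ.1
  have hC : ((M p)⁻¹ * Φ p).det ≠ 0 := by
    rw [Matrix.det_mul]
    refine mul_ne_zero ?_ hΦ.2
    rw [Matrix.det_nonsing_inv, Ring.inverse_eq_inv']
    exact inv_ne_zero hdet.self_of_nhds
  -- The conjugating matrix depends only on the germs at `p`, so `Q` is fixed before any loop is
  -- chosen.
  obtain ⟨Q, hQ, heval⟩ := PainleveSix.exists_polynomial_conj_explicitMonodromy c
    ((M p)⁻¹ * Φ p)⁻¹ ((M p)⁻¹ * Φ p)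
  refine ⟨Q, hQ, fun α => ?_⟩
  have hmon := α.isMonodromyMatrix hb hball hY hI hJ k0 k1 kt hC hΦM
  have huniq : ∀ T, PainleveSix.IsMonodromyMatrix Φ α.lam T → T = _ := fun T hT =>
    hT.unique α.piecewiseC1_lam.continuousOn α.lam_one hΦ.2 hmon
  refine ⟨⟨_, hmon, huniq⟩, fun T hT i j => ?_⟩
  rw [huniq T hT, heval]
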